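/- For $n\ge 4$ let $X$ be the (finite) set of $0$-$1$ incidence matrices $x=(x_{ij})\in\mathbb{R}^{n\times n}$ of the Hamiltonian cycles of the complete graph $K_n$ ($x_{ij}=1$ iff $\{i,j\}$ is an edge of the cycle), and let $\mathbb{R}^X$ be the space of all functions $X\to\mathbb{R}$. Let $L\subset\mathbb{R}^X$ be the subspace of linear functions, i.e. functions of the form $f(x)=\langle c,x\rangle=\sum_{i,j}c_{ij}x_{ij}$ with $c\in\mathbb{R}^{n\times n}$, let $\mathbb{1}\in\mathbb{R}^X$ be the constant function $1$, and let $$Q=\Bigl\{f\in L:\ f(x)\ge 0\ \text{for all }x\in X,\ \ \tfrac1{|X|}\sum_{x\in X}f(x)=1\Bigr\},$$ the (reflected and shifted) polar of the Symmetric Traveling Salesman Polytope $\operatorname{conv}(X)$. A path subset is a set $\Gamma$ of edges of $K_n$ that is the edge set of a family of pairwise vertex-disjoint paths; its normalized indicator $g_\Gamma\in\mathbb{R}^X$ takes the value $|X|/|A_\Gamma|$ on the set $A_\Gamma\subset X$ of Hamiltonian cycles that contain all edges of $\Gamma$, and the value $0$ elsewhere. Theorem. There are absolute constants $C$ and $D$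 such that for all integers $n\ge4$ and $0\le k\le n^{1/3}$ there exist a polytope $P_k\subset\mathbb{R}^X$ with at most $C\,n^{4k}$ vertices, each vertex being $g_\Gamma$ for some path subset $\Gamma$, and a real number $c_k$ with $$\Bigl|c_k-\frac kn\Bigr|\le\frac Dn,\qquad c_k>0\ \text{ if }k\ge1,$$ such that $$c_k(Q-\mathbb{1})\subset P_k\cap L-\mathbb{1}\subset Q-\mathbb{1}.$$ -/

import Mathlib

open scoped Pointwise

noncomputable section

namespace STSP

/-- The `0`-`1` incidence matrix `(a i j)` of a set `E` of edges of `K_n`: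
`a i j = 1` if `{i, j} ∈ E`, and `a i j = 0` otherwise. -/
def incidence {n : ℕ} (E : Set (Sym2 (Fin n))) : Matrix (Fin n) (Fin n) ℝ :=
  open Classical in fun i j => if s(i, j) ∈ E then 1 else 0

/-- The set `X` of incidence matrices of the Hamiltonian cycles of the complete graph `K_n`. -/
def X (n : ℕ) : Set (Matrix (Fin n) (Fin n) ℝ) :=
  {A | ∃ (u : Fin n) (w : (⊤ : SimpleGraph (Fin n)).Walk u u),
    w.IsHamiltonianCycle ∧ A = incidence {e | e ∈ w.edges}}

theorem X_finite (n : ℕ) : (X n).Finite :=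
  (Set.finite_range (incidence (n := n))).subset
    (by rintro A ⟨u, w, _, rfl⟩; exact ⟨_, rfl⟩)

instance (n : ℕ) : Fintype (X n) := (X_finite n).fintype

/-- The space `L` of linear functions on `X`: the functions `f x = ⟨c, x⟩` for a matrix `c`,
i.e. the restrictions to `X` of the linear functions on `ℝ^(n²)`. -/
def L (n : ℕ) : Submodule ℝ (X n → ℝ) where
  carrier := {f | ∃ c : Matrix (Fin n) (Fin n) ℝ, ∀ x : X n, f x = ∑ i, ∑ j, c i j * x.1 i j}
  add_mem' := by
    rintro f g ⟨c, hc⟩ ⟨d, hd⟩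
    exact ⟨c + d, fun x => by simp [hc, hd, add_mul, Finset.sum_add_distrib]⟩
  zero_mem' := ⟨0, fun x => by simp⟩
  smul_mem' := by
    rintro r f ⟨c, hc⟩
    exact ⟨r • c, fun x => by simp [hc, mul_assoc, Finset.mul_sum]⟩

/-- The (reflected and shifted) polar `Q` of the symmetric traveling salesman polytope: the linear
functions on `X` that are nonnegative and have average `1`. -/
def Q (n : ℕ) : Set (X n → ℝ) :=
  {f | f ∈ L n ∧ (∀ x, 0 ≤ f x) ∧ (1 / (Fintype.card (X n) : ℝ)) * ∑ x, f x = 1}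

/-- A path subset: a set of edges of `K_n` that is the set of all edges of a finite family of
pairwise vertex-disjoint paths. -/
def IsPathSubset {n : ℕ} (Γ : Set (Sym2 (Fin n))) : Prop :=
  ∃ (m : ℕ) (u v : Fin m → Fin n)
    (p : ∀ a : Fin m, (⊤ : SimpleGraph (Fin n)).Walk (u a) (v a)),
    (∀ a, (p a).IsPath) ∧
    (∀ a b, a ≠ b → ∀ z, z ∈ (p a).support → z ∉ (p b).support) ∧
    Γ = {e | ∃ a, e ∈ (p a).edges}

/-- `A_Γ`: the Hamiltonian cycles that contain all the edges in `Γ`. -/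
def containing {n : ℕ} (Γ : Set (Sym2 (Fin n))) : Set (X n) :=
  {x | ∀ i j, s(i, j) ∈ Γ → x.1 i j = 1}

/-- The normalized indicator `g_Γ`: its value is `|X| / |A_Γ|` on the cycles that contain `Γ`, and
`0` on all others. -/
def g {n : ℕ} (Γ : Set (Sym2 (Fin n))) : X n → ℝ :=
  open Classical in fun x =>
    if x ∈ containing Γ then
      (Fintype.card (X n) : ℝ) / (Fintype.card (containing Γ) : ℝ) else 0

/-- A polytope: the convex hull of a finite set. -/
def IsPolytope {E : Type*} [AddCommGroup E] [Module ℝ E] (P : Set E) : Prop :=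
  ∃ S : Set E, S.Finite ∧ P = convexHull ℝ S

/-- The vertices of a polytope: its extreme points. -/
def vertices {E : Type*} [AddCommGroup E] [Module ℝ E] (P : Set E) : Set E :=
  P.extremePoints ℝ

end STSP

end

/-! `P` is the convex hull of the `g Γ` with `Γ` running over all matchings of `k` edges. Each `g Γ`
is nonnegative with average 1, so `P ∩ L ⊆ Q` is immediate. The other inclusion asks that each `f =
⟨c, ·⟩` in `Q`, contracted towards 1, be a nonnegative combination of the `g Γ`.

To each matching `Γ` attach the matrix with entry 1 on `Γ`, zero diagonal and entries `w u + w v`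
elsewhere, where the weight `w` is `a` on matched vertices and `b` on the others. Give `Γ` the
coefficient `F Γ`, the pairing of `c` with this matrix. Two facts suffice.

Nonnegativity (`sum_mul_matchingMatrix_nonneg`): the matrix is an average of Hamiltonian cycles
through `Γ`. Averaging a cycle over the symmetries of `Γ` leaves three free values, on pairs joining
two edges of `Γ`, mixed pairs, and unmatched pairs. Row sums equal to 2 leave one parameter, the
total weight on the first kind of pair (cross pairs). Cycles with cross weight 0 and at least 1
exist, and `k ^ 3 ≤ n` puts the required value between 0 and 1; so a mixture of two cycles attains
it.

Reproduction (`sum_containing_matchingMatrix`): summing `F Γ` over the matchings inside a cycle `x`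
gives an affine function of `f x`. Additivity of the entries matters here: only the frequencies with
which vertices and edges of `x` are covered enter, and these are uniform by dihedral symmetry. After
normalization the slope is `(1 - 2 * a) * k / n`. -/

section Matching

/-! ### Matching matrices as averages over the symmetries of a matching -/

variable {V : Type*} [DecidableEq V]

/-- The centralizer of an involution acts transitively on its support and on its fixed points, by
permutations that move only the vertices involved. -/
theorem exists_perm_commute_of_involutive (μ : Equiv.Perm V) (hμ : ∀ v, μ (μ v) = v) {u u' : V}
    (h : μ u = u ↔ μ u' = u') :
    ∃ γ : Equiv.Perm V, (∀ v, γ (μ v) = μ (γ v)) ∧ γ u = u' ∧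
      ∀ v, v ≠ u → v ≠ u' → v ≠ μ u → v ≠ μ u' → γ v = v := by
  have hinj : ∀ v w, μ v = μ w ↔ v = w := fun v w => μ.injective.eq_iff
  by_cases hc : u' = μ u ∨ μ u = u
  · refine ⟨Equiv.swap u u', fun v => ?_, by simp, fun v h1 h2 _ _ => ?_⟩
    · simp only [Equiv.swap_apply_def]
      grind
    · exact Equiv.swap_apply_of_ne_of_ne h1 h2
  · push Not at hc
    -- Two matching edges have to be exchanged, so both ends move together.
    refine ⟨Equiv.swap u u' * Equiv.swap (μ u) (μ u'), fun v => ?_, ?_, fun v h1 h2 h3 h4 => ?_⟩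
    · simp only [Equiv.Perm.mul_apply, Equiv.swap_apply_def]
      grind
    · simp only [Equiv.Perm.mul_apply, Equiv.swap_apply_def]
      grind
    · simp only [Equiv.Perm.mul_apply, Equiv.swap_apply_def]
      grind

/-- The vertex weight with value `a` on the support of `μ` and `b` off it. -/
def vertexWeight (μ : Equiv.Perm V) (a b : ℝ) (v : V) : ℝ := if μ v = v then b else a

/-- The matrix which is additive in the two vertices, except that the entries on the edges
`{v, μ v}` are raised to `1`, and that the diagonal vanishes. -/
def matchingMatrix (μ : Equiv.Perm V) (a b : ℝ) (u v : V) : ℝ :=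
  if u = v then 0 else
    vertexWeight μ a b u + vertexWeight μ a b v + (1 - 2 * a) * (if v = μ u then 1 else 0)

/-- The pair `u`, `v` joins two different edges of the matching `{w, μ w}`. -/
def IsCross (μ : Equiv.Perm V) (u v : V) : Prop := μ u ≠ u ∧ μ v ≠ v ∧ v ≠ u ∧ v ≠ μ u

instance (μ : Equiv.Perm V) (u v : V) : Decidable (IsCross μ u v) := by
  unfold IsCross; infer_instance

variable [Fintype V]

/-- Invariance makes `q` constant on cross, mixed and unmatched pairs. The cross total gives the
first constant, the row sum at a matched vertex the second, and the row sum at an unmatched vertex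
the third. `hab` and `hab'` are these row sum conditions for the additive values `2 * a`, `a + b`,
`2 * b`; the factor `M` makes `hab` void for the empty matching. -/
theorem eq_matchingMatrix_of_invariant (μ : Equiv.Perm V) (hμ : ∀ v, μ (μ v) = v)
    (q : V → V → ℝ) (hsymm : ∀ u v, q u v = q v u) (hdiag : ∀ u, q u u = 0)
    (hrow : ∀ u, ∑ v, q u v = 2) (hedge : ∀ u, μ u ≠ u → q u (μ u) = 1)
    (hinv : ∀ γ : Equiv.Perm V, (∀ v, γ (μ v) = μ (γ v)) → ∀ u v, q (γ u) (γ v) = q u v)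
    {n M a b : ℝ} (hn : n = Fintype.card V) (hM : M = (Finset.univ.filter fun v => μ v ≠ v).card)
    (hab : M * ((n + M - 4) * a + (n - M) * b) = M) (hab' : M * a + (2 * n - M - 2) * b = 2)
    (hcross : ∑ u, ∑ v, (if IsCross μ u v then q u v else 0) = 2 * a * (M * (M - 2)))
    (u v : V) : q u v = matchingMatrix μ a b u v := by
  have hinj : ∀ v w, μ v = μ w ↔ v = w := fun v w => μ.injective.eq_iff
  have hfix : ((Finset.univ.filter fun v => μ v = v).card : ℝ) = n - M := by
    have := Finset.card_filter_add_card_filter_not (s := (Finset.univ : Finset V)) (fun v => μ v = v)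
    rw [hn, hM, ← Finset.card_univ, ← this]; push_cast; ring
  set R : V → ℝ := fun u => ∑ v, if IsCross μ u v then q u v else 0 with hR
  have hRinv : ∀ γ : Equiv.Perm V, (∀ v, γ (μ v) = μ (γ v)) → ∀ u, R (γ u) = R u := by
    intro γ hγ u
    rw [hR]
    simp only
    rw [← Equiv.sum_comp γ]
    refine Finset.sum_congr rfl fun v _ => ?_
    rw [hinv γ hγ]
    simp [IsCross, ← hγ]
  -- By transitivity the cross total is shared equally among the `M` matched vertices.
  have hRval : ∀ u, μ u ≠ u → R u = 2 * a * (M - 2) := by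
    intro u hu
    have h1 : ∑ v, R v = M * R u := by
      have : ∀ v, R v = if μ v ≠ v then R u else 0 := by
        intro v
        split_ifs with hv
        · obtain ⟨γ, hγ, hγu, -⟩ := exists_perm_commute_of_involutive μ hμ (u := u) (u' := v)
            (by simp [hu, hv])
          rw [← hγu, hRinv γ hγ]
        · rw [hR]
          refine Finset.sum_eq_zero fun w _ => if_neg fun h => hv h.1
      rw [Finset.sum_congr rfl fun v _ => this v, ← Finset.sum_filter, Finset.sum_const, hM,
        nsmul_eq_mul]
    have hMpos : 0 < M := by
      rw [hM]; exact_mod_cast Finset.card_pos.2 ⟨u, by simp [hu]⟩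
    have h2 : M * R u = M * (2 * a * (M - 2)) := by
      rw [← h1, hR, hcross]; ring
    exact mul_left_cancel₀ hMpos.ne' h2
  have hcard : ∀ u, μ u ≠ u → ((Finset.univ.filter fun v => IsCross μ u v).card : ℝ) = M - 2 := by
    intro u hu
    have h1 : (Finset.univ.filter fun v => IsCross μ u v)
        = (Finset.univ.filter fun v => μ v ≠ v) \ {u, μ u} := by
      ext v; simp [IsCross, hu]
    have h2 : ({u, μ u} : Finset V) ⊆ Finset.univ.filter fun v => μ v ≠ v := by
      intro v; simp only [Finset.mem_insert, Finset.mem_singleton, Finset.mem_filter]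
      rintro (rfl | rfl) <;> simp [hu]
    have h3 := Finset.card_sdiff_add_card_eq_card h2
    rw [← h1, Finset.card_pair hu.symm] at h3
    rw [hM, ← h3]; push_cast; ring
  have hcr : ∀ u v, IsCross μ u v → q u v = 2 * a := by
    intro u v huv
    have h1 : R u = (M - 2) * q u v := by
      rw [hR, ← hcard u huv.1]
      simp only
      rw [← Finset.sum_filter, ← nsmul_eq_mul, ← Finset.sum_const]
      refine Finset.sum_congr rfl fun w hw => ?_
      have hw : IsCross μ u w := (Finset.mem_filter.1 hw).2
      obtain ⟨h1, h2, h3, h4⟩ := huv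
      obtain ⟨-, h6, h7, h8⟩ := hw
      -- This symmetry moves only the edges at `v` and `w`, hence fixes `u`.
      obtain ⟨γ, hγ, hγu, hγf⟩ := exists_perm_commute_of_involutive μ hμ (u := v) (u' := w)
        (by simp [h2, h6])
      rw [← hinv γ hγ u v, hγu, hγf u] <;> grind
    have hpos : 0 < M - 2 := by
      rw [← hcard u huv.1]; exact_mod_cast Finset.card_pos.2 ⟨v, by simp [huv]⟩
    rw [hRval u huv.1] at h1
    exact mul_left_cancel₀ hpos.ne' (by linarith)
  have hmix : ∀ u v, μ u ≠ u → μ v = v → q u v = a + b := by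
    intro u v hu hv
    have hne : u ≠ v := by rintro rfl; exact hu hv
    have h1 : ∑ w, q u w = 1 + R u + (n - M) * q u v := by
      have : ∀ w, q u w = (if w = μ u then 1 else 0) + (if IsCross μ u w then q u w else 0)
          + if μ w = w then q u v else 0 := by
        intro w
        by_cases hw : μ w = w
        · rw [if_neg (by grind), if_neg (by simp [IsCross, hw]), if_pos hw]
          obtain ⟨γ, hγ, hγu, hγf⟩ := exists_perm_commute_of_involutive μ hμ (u := v) (u' := w)
            (by simp [hv, hw])
          rw [← hinv γ hγ u v, hγu, hγf u] <;> grind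
        · rw [if_neg hw]
          by_cases h1 : w = μ u
          · rw [if_pos h1, if_neg (by simp [IsCross, h1]), h1, hedge u hu]; ring
          · by_cases h2 : w = u
            · rw [if_neg h1, if_neg (by simp [IsCross, h2]), h2, hdiag]; ring
            · rw [if_neg h1, if_pos ⟨hu, hw, h2, h1⟩]; ring
      rw [Finset.sum_congr rfl fun w _ => this w, Finset.sum_add_distrib, Finset.sum_add_distrib,
        ← hfix, Finset.sum_ite_eq', if_pos (Finset.mem_univ _), ← Finset.sum_filter _ (fun _ => q u v),
        Finset.sum_const, nsmul_eq_mul]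
    have hMpos : 0 < M := by
      rw [hM]; exact_mod_cast Finset.card_pos.2 ⟨u, by simp [hu]⟩
    have hpos : 0 < n - M := by
      rw [← hfix]; exact_mod_cast Finset.card_pos.2 ⟨v, by simp [hv]⟩
    have hab1 := mul_left_cancel₀ hMpos.ne' (hab.trans (mul_one M).symm)
    rw [hrow, hRval u hu] at h1
    exact mul_left_cancel₀ hpos.ne' (by linarith)
  have hfree : ∀ u v, μ u = u → μ v = v → u ≠ v → q u v = 2 * b := by
    intro u v hu hv huv
    have h1 : ∑ w, q u w = M * (a + b) + (n - M - 1) * q u v := by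
      have : ∀ w, q u w = (if μ w ≠ w then a + b else 0) + (if μ w = w then q u v else 0)
          - if w = u then q u v else 0 := by
        intro w
        by_cases hw : μ w = w
        · by_cases hwu : w = u
          · simp [hwu, hu, hdiag]
          · simp only [hw, hwu]
            obtain ⟨γ, hγ, hγu, hγf⟩ := exists_perm_commute_of_involutive μ hμ (u := v) (u' := w)
              (by simp [hv, hw])
            have : q u v = q u w := by rw [← hinv γ hγ u v, hγu, hγf u] <;> grind
            simp [this]
        · have hwu : w ≠ u := by rintro rfl; exact hw hu
          rw [hsymm, hmix w u hw hu]
          simp [hw, hwu]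
      rw [Finset.sum_congr rfl fun w _ => this w, Finset.sum_sub_distrib, Finset.sum_add_distrib,
        Finset.sum_ite_eq', if_pos (Finset.mem_univ _), ← Finset.sum_filter, ← Finset.sum_filter,
        Finset.sum_const, Finset.sum_const, nsmul_eq_mul, nsmul_eq_mul, hfix, ← hM]
      ring
    have hpos : 1 < n - M := by
      rw [← hfix]; exact_mod_cast Finset.one_lt_card.2 ⟨u, by simp [hu], v, by simp [hv], huv⟩
    rw [hrow] at h1
    exact mul_left_cancel₀ (sub_pos.2 hpos).ne' (by linarith)
  unfold matchingMatrix vertexWeight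
  by_cases huv : u = v
  · simp [huv, hdiag]
  rw [if_neg huv]
  by_cases hu : μ u = u <;> by_cases hv : μ v = v
  · rw [hfree u v hu hv huv, if_pos hu, if_pos hv, if_neg (by rw [hu]; exact Ne.symm huv)]; ring
  · rw [hsymm, hmix v u hv hu, if_pos hu, if_neg hv, if_neg (by rw [hu]; exact Ne.symm huv)]; ring
  · rw [hmix u v hu hv, if_neg hu, if_pos hv, if_neg (by grind)]; ring
  · by_cases h : v = μ u
    · rw [if_neg hu, if_neg hv, if_pos h, h, hedge u hu]; ring
    · rw [hcr u v ⟨hu, hv, Ne.symm huv, h⟩, if_neg hu, if_neg hv, if_neg h]; ring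

/-- A linear functional that is nonnegative on all relabelings of `D` is nonnegative on the matching
matrix, if this matrix has the same total weight on cross pairs: it is the average of the
relabelings of `D` that preserve the matching. -/
theorem sum_mul_matchingMatrix_nonneg_of_cross_eq (μ : Equiv.Perm V) (hμ : ∀ v, μ (μ v) = v)
    (D : V → V → ℝ) (hsymm : ∀ u v, D u v = D v u) (hdiag : ∀ u, D u u = 0)
    (hrow : ∀ u, ∑ v, D u v = 2) (hedge : ∀ u, μ u ≠ u → D u (μ u) = 1)
    {n M a b : ℝ} (hn : n = Fintype.card V) (hM : M = (Finset.univ.filter fun v => μ v ≠ v).card)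
    (hab : M * ((n + M - 4) * a + (n - M) * b) = M) (hab' : M * a + (2 * n - M - 2) * b = 2)
    (hcross : ∑ u, ∑ v, (if IsCross μ u v then D u v else 0) = 2 * a * (M * (M - 2)))
    (c : V → V → ℝ) (hc : ∀ σ : Equiv.Perm V, 0 ≤ ∑ u, ∑ v, c u v * D (σ u) (σ v)) :
    0 ≤ ∑ u, ∑ v, c u v * matchingMatrix μ a b u v := by
  -- `e` is the uniform probability on the centralizer of `μ`.
  obtain ⟨e, he0, he1, hecomm, heinv⟩ : ∃ e : Equiv.Perm V → ℝ, (∀ γ, 0 ≤ e γ) ∧ ∑ γ, e γ = 1 ∧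
      (∀ γ, e γ ≠ 0 → ∀ v, γ (μ v) = μ (γ v)) ∧
      ∀ δ : Equiv.Perm V, (∀ v, δ (μ v) = μ (δ v)) → ∀ γ, e (γ * δ) = e γ := by
    classical
    set N : ℝ := ∑ γ : Equiv.Perm V, if ∀ v, γ (μ v) = μ (γ v) then 1 else 0 with hN
    have hNpos : 0 < N := by
      refine Finset.sum_pos' (fun γ _ => by split_ifs <;> simp) ⟨1, Finset.mem_univ _, by simp⟩
    refine ⟨fun γ => (if ∀ v, γ (μ v) = μ (γ v) then 1 else 0) / N, fun γ => ?_, ?_, ?_, ?_⟩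
    · exact div_nonneg (by split_ifs <;> simp) hNpos.le
    · rw [← Finset.sum_div, ← hN, div_self hNpos.ne']
    · intro γ h
      by_contra h'
      simp only [if_neg h', zero_div, ne_eq, not_true_eq_false] at h
    · intro δ hδ γ
      have : (∀ v, (γ * δ) (μ v) = μ ((γ * δ) v)) ↔ ∀ v, γ (μ v) = μ (γ v) := by
        simp only [Equiv.Perm.mul_apply, hδ]
        exact δ.surjective.forall (p := fun v => γ (μ v) = μ (γ v)) |>.symm
      simp only [this]
  set q : V → V → ℝ := fun u v => ∑ γ, e γ * D (γ u) (γ v) with hq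
  have hq' : ∀ u v, q u v = matchingMatrix μ a b u v := by
    refine eq_matchingMatrix_of_invariant μ hμ q (fun u v => ?_) (fun u => ?_) (fun u => ?_)
      (fun u hu => ?_) (fun δ hδ u v => ?_) hn hM hab hab' ?_
    · simp only [hq, hsymm]
    · simp only [hq, hdiag, mul_zero, Finset.sum_const_zero]
    · simp only [hq]
      rw [Finset.sum_comm, Finset.sum_congr rfl fun γ _ => (Finset.mul_sum _ _ _).symm,
        Finset.sum_congr rfl fun γ _ => congrArg (e γ * ·)
          ((Equiv.sum_comp γ (D (γ u))).trans (hrow (γ u))), ← Finset.sum_mul, he1, one_mul]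
    · simp only [hq]
      rw [← he1]
      refine Finset.sum_congr rfl fun γ _ => ?_
      by_cases h : e γ = 0
      · rw [h, zero_mul]
      · rw [hecomm γ h, hedge _ (by rw [← hecomm γ h]; simpa using hu), mul_one]
    · simp only [hq]
      rw [← Equiv.sum_comp (Equiv.mulRight δ) fun γ => e γ * D (γ u) (γ v)]
      simp [heinv δ hδ]
    · rw [← hcross]
      simp only [hq]
      have : ∀ u v, (if IsCross μ u v then ∑ γ, e γ * D (γ u) (γ v) else 0)
          = ∑ γ, e γ * if IsCross μ (γ u) (γ v) then D (γ u) (γ v) else 0 := by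
        intro u v
        have key : ∀ γ, e γ * (if IsCross μ (γ u) (γ v) then D (γ u) (γ v) else 0)
            = if IsCross μ u v then e γ * D (γ u) (γ v) else 0 := by
          intro γ
          by_cases h : e γ = 0
          · simp [h]
          · have : IsCross μ (γ u) (γ v) ↔ IsCross μ u v := by simp [IsCross, ← hecomm γ h]
            simp [this]
        rw [Finset.sum_congr rfl fun γ _ => key γ]
        split_ifs <;> simp
      simp only [this]
      rw [Finset.sum_congr rfl fun u _ => Finset.sum_comm, Finset.sum_comm]
      simp only [← Finset.mul_sum]
      have : ∀ γ : Equiv.Perm V,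
          ∑ u, ∑ v, (if IsCross μ (γ u) (γ v) then D (γ u) (γ v) else 0)
          = ∑ u, ∑ v, if IsCross μ u v then D u v else 0 := by
        intro γ
        rw [← Equiv.sum_comp γ fun u => ∑ v, if IsCross μ u v then D u v else 0]
        exact Finset.sum_congr rfl fun u _ =>
          Equiv.sum_comp γ fun v => if IsCross μ (γ u) v then D (γ u) v else 0
      simp only [this]
      rw [← Finset.sum_mul, he1, one_mul]
  simp only [← hq', hq, Finset.mul_sum]
  rw [Finset.sum_congr rfl fun u _ => Finset.sum_comm, Finset.sum_comm]
  refine Finset.sum_nonneg fun γ _ => ?_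
  have := mul_nonneg (he0 γ) (hc γ)
  simp only [Finset.mul_sum] at this
  simpa only [mul_left_comm] using this

/-- A linear functional that is nonnegative on all relabelings of `B` is nonnegative on the matching
matrix, if the latter lies between two relabelings of `B` in its weight on cross pairs. -/
theorem sum_mul_matchingMatrix_nonneg (μ : Equiv.Perm V) (hμ : ∀ v, μ (μ v) = v)
    (B : V → V → ℝ) (hsymm : ∀ u v, B u v = B v u) (hdiag : ∀ u, B u u = 0)
    (hrow : ∀ u, ∑ v, B u v = 2)
    {n M a b : ℝ} (hn : n = Fintype.card V) (hM : M = (Finset.univ.filter fun v => μ v ≠ v).card)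
    (hab : M * ((n + M - 4) * a + (n - M) * b) = M) (hab' : M * a + (2 * n - M - 2) * b = 2)
    (τ τ' : Equiv.Perm V) (hτ : ∀ u, μ u ≠ u → B (τ u) (τ (μ u)) = 1)
    (hτ' : ∀ u, μ u ≠ u → B (τ' u) (τ' (μ u)) = 1)
    (h0 : ∑ u, ∑ v, (if IsCross μ u v then B (τ u) (τ v) else 0) ≤ 2 * a * (M * (M - 2)))
    (h1 : 2 * a * (M * (M - 2)) ≤ ∑ u, ∑ v, (if IsCross μ u v then B (τ' u) (τ' v) else 0))
    (c : V → V → ℝ) (hc : ∀ σ : Equiv.Perm V, 0 ≤ ∑ u, ∑ v, c u v * B (σ u) (σ v)) :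
    0 ≤ ∑ u, ∑ v, c u v * matchingMatrix μ a b u v := by
  -- Mix the two relabelings so that the cross weight is exactly the prescribed one.
  obtain ⟨w, w', hw, hw', hww, hcross⟩ := (segment_eq_Icc (𝕜 := ℝ) (h0.trans h1)).ge ⟨h0, h1⟩
  refine sum_mul_matchingMatrix_nonneg_of_cross_eq μ hμ
    (fun u v => w * B (τ u) (τ v) + w' * B (τ' u) (τ' v)) (fun u v => ?_) (fun u => ?_)
    (fun u => ?_) (fun u hu => ?_) hn hM hab hab' ?_ c fun σ => ?_
  · rw [hsymm (τ u), hsymm (τ' u)]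
  · simp only [hdiag]; ring
  · rw [Finset.sum_add_distrib, ← Finset.mul_sum, ← Finset.mul_sum, Equiv.sum_comp τ (B (τ u)),
      Equiv.sum_comp τ' (B (τ' u)), hrow, hrow]
    linear_combination 2 * hww
  · simp only [hτ u hu, hτ' u hu]; linear_combination hww
  · rw [← hcross]
    simp only [smul_eq_mul, Finset.mul_sum, ← Finset.sum_add_distrib]
    refine Finset.sum_congr rfl fun u _ => Finset.sum_congr rfl fun v _ => ?_
    split_ifs <;> simp
  · have := add_nonneg (mul_nonneg hw (hc (τ * σ))) (mul_nonneg hw' (hc (τ' * σ)))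
    simp only [Finset.mul_sum, ← Finset.sum_add_distrib] at this
    refine this.trans_eq (Finset.sum_congr rfl fun u _ => Finset.sum_congr rfl fun v _ => ?_)
    simp only [Equiv.Perm.mul_apply]; ring

end Matching

/-! ### Averaging matching matrices inside a fixed graph -/

section Counting

variable {V : Type*} [Fintype V] [DecidableEq V]

/-- The permutations that map the matching `{v, μ v}` into the graph with adjacency matrix `B`. -/
noncomputable def matchingPlacements (μ : Equiv.Perm V) (B : V → V → ℝ) : Finset (Equiv.Perm V) :=
  open Classical in Finset.univ.filter fun σ => ∀ v, μ v ≠ v → B (σ v) (σ (μ v)) = 1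

theorem mem_matchingPlacements {μ : Equiv.Perm V} {B : V → V → ℝ} {σ : Equiv.Perm V} :
    σ ∈ matchingPlacements μ B ↔ ∀ v, μ v ≠ v → B (σ v) (σ (μ v)) = 1 := by
  simp [matchingPlacements]

theorem sum_matchingPlacements_mul_left (μ : Equiv.Perm V) (B : V → V → ℝ) (ρ : Equiv.Perm V)
    (hρ : ∀ u v, B (ρ u) (ρ v) = B u v) (φ : Equiv.Perm V → ℝ) :
    ∑ σ ∈ matchingPlacements μ B, φ (ρ * σ) = ∑ σ ∈ matchingPlacements μ B, φ σ := by
  refine Finset.sum_equiv (Equiv.mulLeft ρ) (fun σ => ?_) fun σ _ => rfl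
  simp [mem_matchingPlacements, hρ]

/-- Off the diagonal the entry is affine in three indicators: `u` is matched, `v` is matched, `{u,
v}` is a matching edge. As the automorphisms of `B` are transitive on directed edges, all vertices
are covered equally often (`C`), and so are all edges (`h`). -/
theorem sum_matchingPlacements_matchingMatrix (μ : Equiv.Perm V)
    (B : V → V → ℝ) (hdiag : ∀ u, B u u = 0) (hB : ∀ u v, B u v = 0 ∨ B u v = 1)
    (hrow : ∀ u, ∑ v, B u v = 2)
    (htrans : ∀ u v u' v', B u v = 1 → B u' v' = 1 →
      ∃ ρ : Equiv.Perm V, ρ u = u' ∧ ρ v = v' ∧ ∀ x y, B (ρ x) (ρ y) = B x y)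
    {n M : ℝ} (a b : ℝ) (hn : n = Fintype.card V)
    (hM : M = (Finset.univ.filter fun v => μ v ≠ v).card) (u v : V) :
    ∑ σ ∈ matchingPlacements μ B, matchingMatrix μ a b (σ⁻¹ u) (σ⁻¹ v) =
      ((matchingPlacements μ B).card : ℝ) / n * ((if u = v then 0 else 2 * (a * M + b * (n - M))) +
        (1 - 2 * a) * (M / 2) * B u v) := by
  set N : ℝ := ((matchingPlacements μ B).card : ℝ) with hN
  set C : V → ℝ := fun u => ∑ σ ∈ matchingPlacements μ B, if μ (σ⁻¹ u) ≠ σ⁻¹ u then 1 else 0 with hC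
  set h : V → V → ℝ := fun u v =>
    ∑ σ ∈ matchingPlacements μ B, if u ≠ v ∧ σ⁻¹ v = μ (σ⁻¹ u) then 1 else 0 with hh
  have hn0 : 0 < n := by rw [hn]; exact_mod_cast Fintype.card_pos_iff.2 ⟨u⟩
  have hnb : ∀ u, ∃ v, B u v = 1 := by
    intro u
    by_contra! hne
    have := hrow u
    rw [Finset.sum_eq_zero fun v _ => (hB u v).resolve_right (hne v)] at this
    norm_num at this
  have hCconst : ∀ u u', C u' = C u := by
    intro u u'
    obtain ⟨v, hv⟩ := hnb u
    obtain ⟨v', hv'⟩ := hnb u'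
    obtain ⟨ρ, rfl, -, hρ⟩ := htrans u v u' v' hv hv'
    simp only [hC]
    rw [← sum_matchingPlacements_mul_left μ B ρ hρ]
    simp
  have hCval : ∀ u, C u = N * M / n := by
    intro u
    have h1 : ∑ u', C u' = n * C u := by
      rw [Finset.sum_congr rfl fun u' _ => hCconst u u', Finset.sum_const, Finset.card_univ,
        nsmul_eq_mul, hn]
    have h2 : ∑ u', C u' = N * M := by
      simp only [hC]
      rw [Finset.sum_comm]
      have : ∀ σ : Equiv.Perm V, ∑ u, (if μ (σ⁻¹ u) ≠ σ⁻¹ u then (1 : ℝ) else 0) = M := by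
        intro σ
        rw [Equiv.sum_comp σ⁻¹ fun u => if μ u ≠ u then (1 : ℝ) else 0, hM, Finset.sum_boole]
      rw [Finset.sum_congr rfl fun σ _ => this σ, Finset.sum_const, nsmul_eq_mul]
    rw [eq_div_iff hn0.ne', ← h2, h1, mul_comm]
  have hh0 : ∀ u v, B u v = 0 → h u v = 0 := by
    intro u v huv
    refine Finset.sum_eq_zero fun σ hσ => if_neg ?_
    rintro ⟨hne, he⟩
    have := mem_matchingPlacements.1 hσ (σ⁻¹ u) (by rw [← he]; simpa using Ne.symm hne)
    rw [← he] at this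
    simp [huv] at this
  have hhconst : ∀ u v v', B u v = 1 → B u v' = 1 → h u v' = h u v := by
    intro u v v' hv hv'
    obtain ⟨ρ, hρu, rfl, hρ⟩ := htrans u v u v' hv hv'
    conv_lhs => rw [← hρu]
    simp only [hh]
    rw [← sum_matchingPlacements_mul_left μ B ρ hρ]
    simp
  have hhval : ∀ u v, h u v = N * M / n / 2 * B u v := by
    intro u v
    rcases hB u v with huv | huv
    · rw [hh0 u v huv, huv, mul_zero]
    have h1 : ∑ w, h u w = 2 * h u v := by
      have : ∀ w, h u w = B u w * h u v := by
        intro w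
        rcases hB u w with hw | hw
        · rw [hh0 u w hw, hw, zero_mul]
        · rw [hhconst u v w huv hw, hw, one_mul]
      rw [Finset.sum_congr rfl fun w _ => this w, ← Finset.sum_mul, hrow]
    have h2 : ∑ w, h u w = C u := by
      simp only [hh, hC]
      rw [Finset.sum_comm]
      refine Finset.sum_congr rfl fun σ _ => ?_
      have : ∀ w, (if u ≠ w ∧ σ⁻¹ w = μ (σ⁻¹ u) then (1 : ℝ) else 0)
          = if w = σ (μ (σ⁻¹ u)) then (if μ (σ⁻¹ u) ≠ σ⁻¹ u then 1 else 0) else 0 := by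
        intro w
        have he : σ⁻¹ w = μ (σ⁻¹ u) ↔ w = σ (μ (σ⁻¹ u)) := Equiv.Perm.inv_eq_iff_eq
        by_cases hw : w = σ (μ (σ⁻¹ u))
        · have : u ≠ w ↔ μ (σ⁻¹ u) ≠ σ⁻¹ u := by
            rw [hw, ne_eq, ne_eq, not_iff_not, ← Equiv.Perm.inv_eq_iff_eq, eq_comm]
          rw [if_pos hw]
          exact if_congr (by rw [this, and_iff_left (he.2 hw)]) rfl rfl
        · rw [if_neg hw, if_neg fun h => hw (he.1 h.2)]
      rw [Finset.sum_congr rfl fun w _ => this w, Finset.sum_ite_eq', if_pos (Finset.mem_univ _)]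
    rw [huv, ← hCval u, ← h2, h1]; ring
  by_cases huv : u = v
  · simp [huv, matchingMatrix, hdiag]
  rw [if_neg huv]
  have key : ∀ σ : Equiv.Perm V, matchingMatrix μ a b (σ⁻¹ u) (σ⁻¹ v)
      = b + b + (a - b) * (if μ (σ⁻¹ u) ≠ σ⁻¹ u then 1 else 0)
        + (a - b) * (if μ (σ⁻¹ v) ≠ σ⁻¹ v then 1 else 0)
        + (1 - 2 * a) * (if u ≠ v ∧ σ⁻¹ v = μ (σ⁻¹ u) then 1 else 0) := by
    intro σ
    unfold matchingMatrix vertexWeight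
    rw [if_neg (by simpa using huv)]
    simp only [ne_eq, huv, not_false_eq_true, true_and, ite_not]
    split_ifs <;> ring
  simp only [key, Finset.sum_add_distrib, ← Finset.mul_sum, Finset.sum_const, nsmul_eq_mul, ← hN]
  change N * b + N * b + (a - b) * C u + (a - b) * C v + (1 - 2 * a) * h u v = _
  rw [hCval, hCval, hhval]
  field_simp
  ring

end Counting

/-! ### Hamiltonian cycles as relabelings of one base cycle -/

section CycleMatrix

open SimpleGraph

/-- The adjacency matrix of the cycle graph on `Fin n`. -/
noncomputable def cycleMatrix (n : ℕ) (i j : Fin n) : ℝ :=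
  open Classical in if (cycleGraph n).Adj i j then 1 else 0

theorem cycleMatrix_symm {n : ℕ} (i j : Fin n) : cycleMatrix n i j = cycleMatrix n j i := by
  simp only [cycleMatrix, (cycleGraph n).adj_comm]

theorem cycleMatrix_self {n : ℕ} (i : Fin n) : cycleMatrix n i i = 0 := by
  simp [cycleMatrix]

theorem cycleMatrix_eq_zero_or_one {n : ℕ} (i j : Fin n) :
    cycleMatrix n i j = 0 ∨ cycleMatrix n i j = 1 := by
  unfold cycleMatrix; split_ifs <;> simp

theorem cycleMatrix_nonneg {n : ℕ} (i j : Fin n) : 0 ≤ cycleMatrix n i j := by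
  rcases cycleMatrix_eq_zero_or_one i j with h | h <;> simp [h]

theorem cycleMatrix_eq_one_iff {n : ℕ} {i j : Fin n} :
    cycleMatrix n i j = 1 ↔ (cycleGraph n).Adj i j := by
  simp [cycleMatrix]

theorem cycleGraph_adj_iff_eq_add_one {N : ℕ} {i j : Fin (N + 3)} :
    (cycleGraph (N + 3)).Adj i j ↔ j = i + 1 ∨ i = j + 1 := by
  rw [cycleGraph_adj, sub_eq_iff_eq_add', sub_eq_iff_eq_add', or_comm]

theorem cycleGraph_adj_iff_val {N : ℕ} {i j : Fin (N + 3)} :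
    (cycleGraph (N + 3)).Adj i j ↔ i.val + 1 = j.val ∨ j.val + 1 = i.val ∨
      (i.val = 0 ∧ j.val = N + 2) ∨ (j.val = 0 ∧ i.val = N + 2) := by
  have h : ∀ i j : Fin (N + 3), j = i + 1 ↔
      i.val + 1 = j.val ∨ (j.val = 0 ∧ i.val = N + 2) := by
    intro i j
    rw [Fin.ext_iff, Fin.val_add_one]
    have := j.isLt
    split_ifs with hi
    · rw [hi, Fin.val_last]; omega
    · have : i.val ≠ N + 2 := fun h => hi (Fin.ext h)
      omega
  rw [cycleGraph_adj_iff_eq_add_one, h, h]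
  tauto

theorem sum_cycleMatrix {N : ℕ} (i : Fin (N + 3)) : ∑ j, cycleMatrix (N + 3) i j = 2 := by
  classical
  have : (cycleGraph (N + 3)).degree i = 2 := cycleGraph_degree_three_le
  rw [← card_neighborFinset_eq_degree, neighborFinset_eq_filter] at this
  simp only [cycleMatrix]
  rw [Finset.sum_boole]
  exact_mod_cast this

theorem exists_perm_cycleMatrix {N : ℕ} (u v u' v' : Fin (N + 3))
    (h : cycleMatrix (N + 3) u v = 1) (h' : cycleMatrix (N + 3) u' v' = 1) :
    ∃ ρ : Equiv.Perm (Fin (N + 3)), ρ u = u' ∧ ρ v = v' ∧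
      ∀ x y, cycleMatrix (N + 3) (ρ x) (ρ y) = cycleMatrix (N + 3) x y := by
  rw [cycleMatrix_eq_one_iff, cycleGraph_adj_iff_eq_add_one] at h h'
  have hadd : ∀ x y, cycleMatrix (N + 3) (Equiv.addRight (u' - u) x) (Equiv.addRight (u' - u) y)
      = cycleMatrix (N + 3) x y := by
    intro x y
    simp only [cycleMatrix, cycleGraph_adj, Equiv.coe_addRight, add_sub_add_right_eq_sub]
  have hsub : ∀ x y, cycleMatrix (N + 3) (Equiv.subLeft (u' + u) x) (Equiv.subLeft (u' + u) y)
      = cycleMatrix (N + 3) x y := by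
    intro x y
    simp only [cycleMatrix, cycleGraph_adj, Equiv.subLeft_apply, sub_sub_sub_cancel_left, or_comm]
  rcases h with rfl | rfl <;> rcases h' with rfl | rfl
  · exact ⟨_, by simp, by simp; abel, hadd⟩
  · exact ⟨_, by simp, by simp only [Equiv.subLeft_apply]; abel, hsub⟩
  · exact ⟨_, by simp, by simp only [Equiv.subLeft_apply]; abel, hsub⟩
  · exact ⟨_, by simp only [Equiv.coe_addRight]; abel, by simp, hadd⟩

theorem mk_mem_edges_iff_cycleGraph_adj {N : ℕ} {G : SimpleGraph (Fin (N + 3))}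
    {u : Fin (N + 3)} (w : G.Walk u u) (hw : w.length = N + 3) (f : Equiv.Perm (Fin (N + 3)))
    (hf : ∀ i, f i = w.getVert i) (i j : Fin (N + 3)) :
    s(f i, f j) ∈ w.edges ↔ (cycleGraph (N + 3)).Adj i j := by
  -- At the last index, addition in `Fin` wraps to 0, and the closed walk returns to its start.
  have hsucc : ∀ i : Fin (N + 3), w.getVert (i.val + 1) = f (i + 1) := by
    intro i
    rw [hf, Fin.val_add_one]
    split_ifs with hi
    · rw [hi, Fin.val_last, Walk.getVert_zero]
      exact (congrArg w.getVert hw.symm).trans w.getVert_length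
    · rfl
  rw [Walk.mk_mem_edges_iff_exists, cycleGraph_adj_iff_eq_add_one]
  constructor
  · rintro ⟨k, hk, h⟩
    have h1 := hsucc ⟨k, hw ▸ hk⟩
    have h2 := hf ⟨k, hw ▸ hk⟩
    simp only at h1 h2
    rw [h1, ← h2, Sym2.eq_iff, f.injective.eq_iff, f.injective.eq_iff, f.injective.eq_iff,
      f.injective.eq_iff] at h
    rcases h with ⟨rfl, rfl⟩ | ⟨rfl, rfl⟩ <;> simp
  · rintro (rfl | rfl)
    · exact ⟨i, i.isLt.trans_eq hw.symm, by rw [hsucc, ← hf]⟩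
    · exact ⟨j, j.isLt.trans_eq hw.symm, by rw [hsucc, ← hf, Sym2.eq_swap]⟩

theorem exists_perm_getVert_of_isCycle {N : ℕ} {G : SimpleGraph (Fin (N + 3))}
    {u : Fin (N + 3)} {w : G.Walk u u} (hc : w.IsCycle) (hw : w.length = N + 3) :
    ∃ f : Equiv.Perm (Fin (N + 3)), ∀ i, f i = w.getVert i := by
  have hinj : Function.Injective fun i : Fin (N + 3) => w.getVert i := by
    intro i j hij
    have := hc.getVert_injOn' (x₁ := i.val) (x₂ := j.val) (by simp; omega) (by simp; omega) hij
    exact Fin.ext this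
  exact ⟨Equiv.ofBijective _ (Finite.injective_iff_bijective.1 hinj), fun i => rfl⟩

theorem incidence_eq_cycleMatrix {n : ℕ} {E : Set (Sym2 (Fin n))} {σ : Equiv.Perm (Fin n)}
    (h : ∀ u v, s(u, v) ∈ E ↔ (cycleGraph n).Adj (σ u) (σ v)) :
    STSP.incidence E = fun u v => cycleMatrix n (σ u) (σ v) := by
  funext u v
  simp only [STSP.incidence, cycleMatrix, h]

/-- Replaces walks by permutations: `σ` sends a vertex to its position along the cycle. -/
theorem mem_X_iff {N : ℕ} (A : Matrix (Fin (N + 3)) (Fin (N + 3)) ℝ) :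
    A ∈ STSP.X (N + 3) ↔ ∃ σ : Equiv.Perm (Fin (N + 3)),
      A = fun u v => cycleMatrix (N + 3) (σ u) (σ v) := by
  constructor
  · rintro ⟨u, w, hw, rfl⟩
    have hlen : w.length = N + 3 := by simpa using hw.length_eq
    obtain ⟨f, hf⟩ := exists_perm_getVert_of_isCycle hw.isCycle hlen
    refine ⟨f⁻¹, ?_⟩
    refine incidence_eq_cycleMatrix fun x y => ?_
    simpa using mk_mem_edges_iff_cycleGraph_adj w hlen f hf (f⁻¹ x) (f⁻¹ y)
  · rintro ⟨σ, rfl⟩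
    have hc := cycleGraph.isCycle_cycle (n := N)
    obtain ⟨f, hf⟩ := exists_perm_getVert_of_isCycle hc (by simp)
    have hadj := mk_mem_edges_iff_cycleGraph_adj _ (by simp) f hf
    let φ : cycleGraph (N + 3) →g (⊤ : SimpleGraph (Fin (N + 3))) :=
      ⟨fun i => σ⁻¹ (f⁻¹ i), fun {a b} h => by simpa using h.ne⟩
    have hφ : Function.Bijective φ := (σ⁻¹ * f⁻¹).bijective
    refine ⟨φ 0, (cycleGraph.cycle N).map φ, Walk.IsHamiltonianCycle.map hφ
      (Walk.isHamiltonianCycle_iff_isCycle_and_length_eq.2 ⟨hc, by simp⟩), ?_⟩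
    refine (incidence_eq_cycleMatrix fun x y => ?_).symm
    have h1 : s(x, y) = Sym2.map φ s(f (σ x), f (σ y)) := by
      simp [φ]
    rw [← hadj, h1, Set.mem_ofPred_eq, Walk.edges_map,
      List.mem_map_of_injective (Sym2.map.injective hφ.1)]

end CycleMatrix

/-! ### The standard matching, its weights and nonnegativity -/

section TripleSwap

/-- The involution of `Fin n` that exchanges `3 * a` and `3 * a + 1` for all `a < k`. -/
def tripleSwap {n k : ℕ} (h : 3 * k ≤ n) : Equiv.Perm (Fin n) :=
  Function.Involutive.toPerm
    (fun j => ⟨if j.val < 3 * k ∧ j.val % 3 = 0 then j.val + 1 else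
      if j.val < 3 * k ∧ j.val % 3 = 1 then j.val - 1 else j.val, by split_ifs <;> omega⟩)
    (fun j => by ext; simp only; split_ifs <;> omega)

theorem val_tripleSwap {n k : ℕ} (h : 3 * k ≤ n) (j : Fin n) :
    (tripleSwap h j).val = if j.val < 3 * k ∧ j.val % 3 = 0 then j.val + 1 else
      if j.val < 3 * k ∧ j.val % 3 = 1 then j.val - 1 else j.val := rfl

theorem tripleSwap_tripleSwap {n k : ℕ} (h : 3 * k ≤ n) (j : Fin n) :
    tripleSwap h (tripleSwap h j) = j :=
  Function.Involutive.toPerm_involutive _ j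

theorem tripleSwap_ne_iff {n k : ℕ} (h : 3 * k ≤ n) {j : Fin n} :
    tripleSwap h j ≠ j ↔ j.val < 3 * k ∧ j.val % 3 ≠ 2 := by
  rw [ne_eq, Fin.ext_iff, val_tripleSwap]
  split_ifs <;> omega

theorem card_support_tripleSwap {n k : ℕ} (h : 3 * k ≤ n) :
    (Finset.univ.filter fun v => tripleSwap h v ≠ v).card = 2 * k := by
  have : (Finset.univ.filter fun v => tripleSwap h v ≠ v) =
      (Finset.univ : Finset (Fin k × Fin 2)).image
        fun p => ⟨3 * p.1.val + p.2.val, by have := p.1.isLt; have := p.2.isLt; omega⟩ := by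
    ext j
    simp only [Finset.mem_filter, Finset.mem_univ, true_and, Finset.mem_image, tripleSwap_ne_iff,
      Fin.ext_iff, Prod.exists]
    constructor
    · rintro ⟨h1, h2⟩
      exact ⟨⟨j.val / 3, by omega⟩, ⟨j.val % 3, by omega⟩, by simp only; omega⟩
    · rintro ⟨a, b, hab⟩
      have := a.isLt
      have := b.isLt
      omega
  rw [this, Finset.card_image_of_injective, Finset.card_univ, Fintype.card_prod, Fintype.card_fin,
    Fintype.card_fin, mul_comm]
  rintro ⟨a, b⟩ ⟨a', b'⟩ hab
  simp only [Fin.ext_iff, Prod.mk.injEq] at hab ⊢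
  have := b.isLt
  have := b'.isLt
  omega

theorem cycleMatrix_tripleSwap {N k : ℕ} (h : 3 * k ≤ N + 3) {u : Fin (N + 3)}
    (hu : tripleSwap h u ≠ u) : cycleMatrix (N + 3) u (tripleSwap h u) = 1 := by
  rw [cycleMatrix_eq_one_iff, cycleGraph_adj_iff_val, val_tripleSwap]
  rw [tripleSwap_ne_iff] at hu
  split_ifs <;> omega

/-- The unmatched vertices `3 * a + 2` separate consecutive matching edges along the base cycle, so
this cycle has cross weight 0. -/
theorem cycleMatrix_eq_zero_of_isCross {N k : ℕ} (h : 3 * k ≤ N + 3) (h' : 3 * k ≤ N + 2)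
    {u v : Fin (N + 3)} (huv : IsCross (tripleSwap h) u v) : cycleMatrix (N + 3) u v = 0 := by
  refine (cycleMatrix_eq_zero_or_one u v).resolve_right fun hadj => ?_
  rw [cycleMatrix_eq_one_iff, cycleGraph_adj_iff_val] at hadj
  obtain ⟨h1, h2, h3, h4⟩ := huv
  rw [tripleSwap_ne_iff] at h1 h2
  rw [ne_eq, Fin.ext_iff] at h3 h4
  rw [val_tripleSwap] at h4
  split_ifs at h4 <;> omega

/-- A Hamiltonian cycle that contains the edges `{3 * a, 3 * a + 1}` and the cross edge `{1, 3}`. -/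
theorem exists_perm_cross_ge_one {N k : ℕ} (hk : 2 ≤ k) (h : 3 * k ≤ N + 3) :
    ∃ τ : Equiv.Perm (Fin (N + 3)),
      (∀ u, tripleSwap h u ≠ u → cycleMatrix (N + 3) (τ u) (τ (tripleSwap h u)) = 1) ∧
      1 ≤ ∑ u, ∑ v, if IsCross (tripleSwap h) u v then cycleMatrix (N + 3) (τ u) (τ v) else 0 := by
  let x (i : ℕ) (hi : i < 6) : Fin (N + 3) := ⟨i, by omega⟩
  -- The new cycle visits 0, 1, 3, 4, 2, 5, and so on: vertex 2 is moved behind the second matching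
  -- edge.
  let τ : Equiv.Perm (Fin (N + 3)) :=
    Equiv.swap (x 3 (by omega)) (x 4 (by omega)) * Equiv.swap (x 2 (by omega)) (x 3 (by omega))
  have hτ : ∀ j, (τ j).val = if j.val = 2 then 4 else if j.val = 3 then 2 else
      if j.val = 4 then 3 else j.val := by
    intro j
    simp only [τ, x, Equiv.Perm.mul_apply, Equiv.swap_apply_def, Fin.ext_iff]
    split_ifs <;> simp_all
  refine ⟨τ, fun u hu => ?_, ?_⟩
  · rw [cycleMatrix_eq_one_iff, cycleGraph_adj_iff_val, hτ, hτ, val_tripleSwap]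
    rw [tripleSwap_ne_iff] at hu
    split_ifs <;> omega
  · have hnn : ∀ u v, 0 ≤ if IsCross (tripleSwap h) u v then cycleMatrix (N + 3) (τ u) (τ v)
        else 0 := fun u v => by split_ifs; exacts [cycleMatrix_nonneg _ _, le_rfl]
    refine le_trans (le_of_eq ?_) ((Finset.single_le_sum (fun v _ => hnn (x 1 (by omega)) v)
      (Finset.mem_univ (x 3 (by omega)))).trans (Finset.single_le_sum
      (f := fun u => ∑ v, if IsCross (tripleSwap h) u v then cycleMatrix (N + 3) (τ u) (τ v) else 0)
      (fun u _ => Finset.sum_nonneg fun v _ => hnn u v) (Finset.mem_univ (x 1 (by omega)))))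
    rw [if_pos, eq_comm, cycleMatrix_eq_one_iff, cycleGraph_adj_iff_val, hτ, hτ]
    · simp [x]
    · refine ⟨(tripleSwap_ne_iff h).2 ?_, (tripleSwap_ne_iff h).2 ?_, ?_, ?_⟩
      · change 1 < 3 * k ∧ 1 % 3 ≠ 2
        omega
      · change 3 < 3 * k ∧ 3 % 3 ≠ 2
        omega
      · simp [x]
      · rw [ne_eq, Fin.ext_iff, val_tripleSwap]
        simp only [x]
        split_ifs <;> simp

/-- The weights `a`, `b` for which the matching matrix of `k` edges has all row sums `2`. -/
theorem exists_matching_weights {n k : ℕ} (hn : 4 ≤ n) (hk : k ^ 3 ≤ n) :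
    ∃ a b : ℝ, 0 ≤ a ∧ 2 * a < 1 ∧ 2 * a * k ≤ 1 ∧
      (2 * k : ℝ) * ((n + 2 * k - 4) * a + (n - 2 * k) * b) = 2 * k ∧
      2 * k * a + (2 * n - 2 * k - 2) * b = 2 ∧
      0 ≤ 2 * a * (2 * k * (2 * k - 2)) ∧ 2 * a * (2 * k * (2 * k - 2)) ≤ 1 ∧
      (k ≤ 1 → a = 0) := by
  have hn' : (4 : ℝ) ≤ n := by exact_mod_cast hn
  rcases Nat.eq_zero_or_pos k with rfl | hkpos
  · refine ⟨0, 1 / (n - 1), by simp, by simp, by simp, by simp, ?_, by simp, by simp, by simp⟩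
    have : (n : ℝ) - 1 ≠ 0 := by linarith
    simp only [CharP.cast_eq_zero]
    field_simp
    ring
  have hk1 : (1 : ℝ) ≤ k := by exact_mod_cast hkpos
  have hk3 : (k : ℝ) ^ 3 ≤ n := by exact_mod_cast hk
  -- The determinant of the two row sum equations in `a`, `b` with `M = 2 * k`; the witnesses come
  -- from Cramer's rule.
  set D : ℝ := 2 * (n - 1) * (n - 4) + 4 * k with hD
  have hDk : 4 * (k : ℝ) ≤ D := by nlinarith [mul_nonneg (by linarith : (0 : ℝ) ≤ n - 1) (by linarith : (0 : ℝ) ≤ n - 4)]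
  have hDpos : 0 < D := by linarith
  -- Says that the total cross weight is at most 1.
  have hbound : 16 * (k : ℝ) * (k - 1) ^ 2 ≤ D := by
    rcases (by omega : k = 1 ∨ k = 2 ∨ 3 ≤ k) with rfl | rfl | hk'
    · norm_num; linarith
    · have hn8 : (8 : ℝ) ≤ n := by exact_mod_cast hk
      rw [hD]; push_cast; nlinarith
    · have hk' : (3 : ℝ) ≤ k := by exact_mod_cast hk'
      have hn27 : (27 : ℝ) ≤ n := le_trans (by nlinarith [pow_le_pow_left₀ (by norm_num) hk' 3]) hk3
      have h1 : 16 * (k : ℝ) * (k - 1) ^ 2 ≤ 16 * k ^ 3 := by nlinarith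
      nlinarith
  have hbound' : 4 * (k : ℝ) * (k - 1) ≤ D := by
    rcases (by omega : k = 1 ∨ 2 ≤ k) with rfl | hk'
    · norm_num; linarith
    · have hk' : (2 : ℝ) ≤ k := by exact_mod_cast hk'
      refine le_trans ?_ hbound
      have : 0 ≤ (k : ℝ) * (k - 1) := by nlinarith
      nlinarith
  refine ⟨2 * (k - 1) / D, (2 * n + 2 * k - 8) / D, ?_, ?_, ?_, ?_, ?_, ?_, ?_, ?_⟩
  · exact div_nonneg (by linarith) hDpos.le
  · rw [mul_div_assoc', div_lt_one hDpos]; linarith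
  · rw [mul_div_assoc', div_mul_eq_mul_div, div_le_one hDpos]; linarith
  · field_simp; rw [hD]; ring
  · field_simp; rw [hD]; ring
  · exact mul_nonneg (mul_nonneg zero_le_two (div_nonneg (by linarith) hDpos.le))
      (mul_nonneg (by linarith) (by linarith))
  · rw [mul_div_assoc', div_mul_eq_mul_div, div_le_one hDpos]; linarith
  · intro h
    have : k = 1 := by omega
    simp [this]

/-- A linear functional that is nonnegative on all Hamiltonian cycles is nonnegative on all
relabelings of the matching matrix. -/
theorem sum_mul_matchingMatrix_tripleSwap_nonneg {N k : ℕ} (h : 3 * k ≤ N + 3) (h' : 3 * k ≤ N + 2)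
    {a b : ℝ} (hab : (2 * k : ℝ) * ((((N + 3 : ℕ) : ℝ) + 2 * k - 4) * a
      + (((N + 3 : ℕ) : ℝ) - 2 * k) * b) = 2 * k)
    (hab' : 2 * k * a + (2 * ((N + 3 : ℕ) : ℝ) - 2 * k - 2) * b = 2)
    (h0 : 0 ≤ 2 * a * (2 * k * (2 * k - 2))) (h1 : 2 * a * (2 * k * (2 * k - 2)) ≤ 1)
    (hk : k ≤ 1 → a = 0) (c : Fin (N + 3) → Fin (N + 3) → ℝ)
    (hc : ∀ σ : Equiv.Perm (Fin (N + 3)), 0 ≤ ∑ u, ∑ v, c u v * cycleMatrix (N + 3) (σ u) (σ v))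
    (σ : Equiv.Perm (Fin (N + 3))) :
    0 ≤ ∑ u, ∑ v, c u v * matchingMatrix (tripleSwap h) a b (σ⁻¹ u) (σ⁻¹ v) := by
  have hone : ∑ u, ∑ v, (if IsCross (tripleSwap h) u v then
      cycleMatrix (N + 3) ((1 : Equiv.Perm (Fin (N + 3))) u) ((1 : Equiv.Perm (Fin (N + 3))) v)
      else 0) = 0 := by
    refine Finset.sum_eq_zero fun u _ => Finset.sum_eq_zero fun v _ => ?_
    split_ifs with huv
    · exact cycleMatrix_eq_zero_of_isCross h h' huv
    · rfl
  obtain ⟨τ, hτ, hτ1⟩ : ∃ τ : Equiv.Perm (Fin (N + 3)),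
      (∀ u, tripleSwap h u ≠ u → cycleMatrix (N + 3) (τ u) (τ (tripleSwap h u)) = 1) ∧
      2 * a * (2 * k * (2 * k - 2)) ≤
        ∑ u, ∑ v, if IsCross (tripleSwap h) u v then cycleMatrix (N + 3) (τ u) (τ v) else 0 := by
    rcases (by omega : k ≤ 1 ∨ 2 ≤ k) with hk1 | hk2
    · exact ⟨1, fun u hu => cycleMatrix_tripleSwap h hu, by rw [hone, hk hk1]; simp⟩
    · obtain ⟨τ, hτ, hτ1⟩ := exists_perm_cross_ge_one hk2 h
      exact ⟨τ, hτ, h1.trans hτ1⟩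
  have key := sum_mul_matchingMatrix_nonneg (tripleSwap h) (tripleSwap_tripleSwap h)
    (cycleMatrix (N + 3)) cycleMatrix_symm cycleMatrix_self sum_cycleMatrix
    (n := ((N + 3 : ℕ) : ℝ)) (M := 2 * k) (a := a) (b := b) (by simp)
    (by rw [card_support_tripleSwap]; simp) hab hab' 1 τ (fun u hu => cycleMatrix_tripleSwap h hu) hτ
    (hone.trans_le h0) hτ1 (fun u v => c (σ u) (σ v)) fun π => by
      refine (hc (π * σ⁻¹)).trans_eq ?_
      rw [← Equiv.sum_comp σ]
      refine Finset.sum_congr rfl fun u _ => ?_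
      rw [← Equiv.sum_comp σ]
      simp
  refine key.trans_eq ?_
  rw [← Equiv.sum_comp σ fun u => ∑ v, c u v * matchingMatrix (tripleSwap h) a b (σ⁻¹ u) (σ⁻¹ v)]
  refine Finset.sum_congr rfl fun u _ => ?_
  rw [← Equiv.sum_comp σ fun v =>
    c (σ u) v * matchingMatrix (tripleSwap h) a b (σ⁻¹ (σ u)) (σ⁻¹ v)]
  simp

end TripleSwap

/-! ### Normalized indicators, averages over all cycles, and the polytope -/

namespace STSP

variable {n : ℕ}

theorem g_nonneg (Γ : Set (Sym2 (Fin n))) (x : X n) : 0 ≤ g Γ x := by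
  unfold g
  split_ifs <;> positivity

theorem sum_g {Γ : Set (Sym2 (Fin n))} (h : (containing Γ).Nonempty) :
    ∑ x, g Γ x = Fintype.card (X n) := by
  classical
  have hne : (Fintype.card (containing Γ) : ℝ) ≠ 0 := by
    have : Nonempty (containing Γ) := h.to_subtype
    exact_mod_cast Fintype.card_ne_zero
  unfold g
  rw [← Finset.sum_filter, Finset.sum_const, nsmul_eq_mul, ← Fintype.card_subtype]
  rw [show Fintype.card {x // x ∈ containing Γ} = Fintype.card (containing Γ) from
    Fintype.card_congr (Equiv.refl _)]
  field_simp

theorem isPolytope_convexHull_range {ι E : Type*} [Finite ι] [AddCommGroup E] [Module ℝ E]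
    (φ : ι → E) : IsPolytope (convexHull ℝ (Set.range φ)) :=
  ⟨_, Set.finite_range φ, rfl⟩

theorem convexHull_range_g_inter_L_subset {ι : Type*} (Γ : ι → Set (Sym2 (Fin n)))
    (h : ∀ i, (containing (Γ i)).Nonempty) :
    convexHull ℝ (Set.range fun i => g (Γ i)) ∩ (L n : Set (X n → ℝ)) ⊆ Q n := by
  rintro f ⟨hf, hfL⟩
  suffices hs : convexHull ℝ (Set.range fun i => g (Γ i)) ⊆
      {f | (∀ x, 0 ≤ f x) ∧ (1 / (Fintype.card (X n) : ℝ)) * ∑ x, f x = 1} from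
    ⟨hfL, hs hf⟩
  refine convexHull_min ?_ ?_
  · rintro _ ⟨i, rfl⟩
    refine ⟨g_nonneg _, ?_⟩
    have : Nonempty (X n) := ⟨(h i).some⟩
    have hne : (Fintype.card (X n) : ℝ) ≠ 0 := by exact_mod_cast Fintype.card_ne_zero
    rw [sum_g (h i), one_div_mul_cancel hne]
  · rintro f ⟨hf, hf'⟩ f' ⟨hg, hg'⟩ s t hs ht hst
    refine ⟨fun x => add_nonneg (mul_nonneg hs (hf x)) (mul_nonneg ht (hg x)), ?_⟩
    simp only [Pi.add_apply, Pi.smul_apply, smul_eq_mul, Finset.sum_add_distrib,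
      ← Finset.mul_sum]
    linear_combination s * hf' + t * hg' + hst

/-- The Hamiltonian cycle whose vertices, in the order of the base cycle, are given by `σ⁻¹`. -/
noncomputable def cycleOf {N : ℕ} (σ : Equiv.Perm (Fin (N + 3))) : X (N + 3) :=
  ⟨fun u v => cycleMatrix (N + 3) (σ u) (σ v), (mem_X_iff _).2 ⟨σ, rfl⟩⟩

theorem exists_eq_cycleOf {N : ℕ} (x : X (N + 3)) : ∃ σ, x = cycleOf σ := by
  obtain ⟨σ, hσ⟩ := (mem_X_iff x.1).1 x.2
  exact ⟨σ, Subtype.ext hσ⟩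

instance {N : ℕ} : Nonempty (X (N + 3)) := ⟨cycleOf 1⟩

theorem sum_sum_X {N : ℕ} (x : X (N + 3)) : ∑ u, ∑ v, x.1 u v = 2 * ((N + 3 : ℕ) : ℝ) := by
  obtain ⟨σ, rfl⟩ := exists_eq_cycleOf x
  have : ∀ u, ∑ v, (cycleOf σ).1 u v = 2 := fun u =>
    (Equiv.sum_comp σ (cycleMatrix (N + 3) (σ u))).trans (sum_cycleMatrix _)
  simp [this, mul_comm]

theorem one_mem_L {N : ℕ} : (1 : X (N + 3) → ℝ) ∈ L (N + 3) := by
  refine ⟨fun _ _ => 1 / (2 * ((N + 3 : ℕ) : ℝ)), fun x => ?_⟩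
  have : (2 * ((N + 3 : ℕ) : ℝ)) ≠ 0 := by positivity
  simp only [← Finset.mul_sum, sum_sum_X, Pi.one_apply]
  rw [one_div_mul_cancel this]

theorem sum_X_perm {N : ℕ} (π : Equiv.Perm (Fin (N + 3))) (u v : Fin (N + 3)) :
    ∑ x : X (N + 3), x.1 (π u) (π v) = ∑ x : X (N + 3), x.1 u v := by
  have hmem : ∀ (π : Equiv.Perm (Fin (N + 3))) (x : X (N + 3)),
      (fun u v => x.1 (π u) (π v)) ∈ X (N + 3) := by
    intro π x
    obtain ⟨σ, rfl⟩ := exists_eq_cycleOf x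
    exact (mem_X_iff _).2 ⟨σ * π, rfl⟩
  refine Finset.sum_bij' (fun x _ => ⟨_, hmem π x⟩) (fun x _ => ⟨_, hmem π⁻¹ x⟩)
    (by simp) (by simp) (fun x _ => ?_) (fun x _ => ?_) fun x _ => rfl
  · ext; simp
  · ext; simp

/-- By symmetry all off-diagonal positions have the same sum, and each cycle has total entry `2 *
n`. -/
theorem sum_X_apply {N : ℕ} (hN : 1 ≤ N) {u v : Fin (N + 3)} (huv : u ≠ v) :
    ∑ x : X (N + 3), x.1 u v = 2 * Fintype.card (X (N + 3)) / (((N + 3 : ℕ) : ℝ) - 1) := by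
  have hconst : ∀ u' v' : Fin (N + 3), u' ≠ v' →
      ∑ x : X (N + 3), x.1 u' v' = ∑ x : X (N + 3), x.1 u v := by
    intro u' v' huv'
    set v₁ := Equiv.swap u u' v with hv₁
    have h1 : v₁ ≠ u' := by
      intro h
      rw [hv₁, Equiv.swap_apply_eq_iff, Equiv.swap_apply_right] at h
      exact huv h.symm
    rw [← sum_X_perm (Equiv.swap v₁ v' * Equiv.swap u u') u v]
    simp only [Equiv.Perm.mul_apply, Equiv.swap_apply_left, ← hv₁,
      Equiv.swap_apply_of_ne_of_ne h1.symm huv']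
  have hself : ∀ (x : X (N + 3)) u, x.1 u u = 0 := by
    intro x u
    obtain ⟨σ, rfl⟩ := exists_eq_cycleOf x
    exact cycleMatrix_self _
  set t := ∑ x : X (N + 3), x.1 u v with ht
  have h1 : ∑ u', ∑ v', ∑ x : X (N + 3), x.1 u' v'
      = ((N + 3 : ℕ) : ℝ) * (((N + 3 : ℕ) : ℝ) - 1) * t := by
    have : ∀ u' v', ∑ x : X (N + 3), x.1 u' v' = t - if v' = u' then t else 0 := by
      intro u' v'
      split_ifs with h
      · simp [h, hself]
      · rw [hconst u' v' (Ne.symm h), sub_zero]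
    simp only [this, Finset.sum_sub_distrib, Finset.sum_ite_eq', Finset.mem_univ, if_true,
      Finset.sum_const, Finset.card_univ, Fintype.card_fin, nsmul_eq_mul]
    ring
  have h2 : ∑ u', ∑ v', ∑ x : X (N + 3), x.1 u' v'
      = Fintype.card (X (N + 3)) * (2 * ((N + 3 : ℕ) : ℝ)) := by
    rw [Finset.sum_congr rfl fun u' _ => Finset.sum_comm, Finset.sum_comm]
    simp only [sum_sum_X, Finset.sum_const, Finset.card_univ, nsmul_eq_mul]
  have hpos : (0 : ℝ) < ((N + 3 : ℕ) : ℝ) := by positivity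
  have hpos' : (0 : ℝ) < ((N + 3 : ℕ) : ℝ) - 1 := by push_cast; linarith [(N.cast_nonneg : (0 : ℝ) ≤ N)]
  rw [eq_div_iff hpos'.ne']
  refine mul_left_cancel₀ hpos.ne' ?_
  linear_combination h2 - h1

/-- The average of `f` sees only the off-diagonal sum of `c`, so average 1 fixes the constant term
in the reproduction formula. -/
theorem sum_offDiag_coeff {N : ℕ} (hN : 1 ≤ N) {f : X (N + 3) → ℝ}
    (hf : (1 / (Fintype.card (X (N + 3)) : ℝ)) * ∑ x, f x = 1)
    {c : Matrix (Fin (N + 3)) (Fin (N + 3)) ℝ} (hc : ∀ x : X (N + 3), f x = ∑ i, ∑ j, c i j * x.1 i j) :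
    ∑ u, ∑ v, (if u = v then 0 else c u v) = (((N + 3 : ℕ) : ℝ) - 1) / 2 := by
  have hne : (Fintype.card (X (N + 3)) : ℝ) ≠ 0 := by exact_mod_cast Fintype.card_ne_zero
  have hpos' : (0 : ℝ) < ((N + 3 : ℕ) : ℝ) - 1 := by
    push_cast; linarith [(N.cast_nonneg : (0 : ℝ) ≤ N)]
  have h1 : ∑ x, f x = (∑ u, ∑ v, (if u = v then 0 else c u v)) *
      (2 * Fintype.card (X (N + 3)) / (((N + 3 : ℕ) : ℝ) - 1)) := by
    simp only [hc]
    rw [Finset.sum_comm, Finset.sum_mul]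
    refine Finset.sum_congr rfl fun u _ => ?_
    rw [Finset.sum_comm, Finset.sum_mul]
    refine Finset.sum_congr rfl fun v _ => ?_
    rw [← Finset.mul_sum]
    split_ifs with h
    · rw [zero_mul, h, Finset.sum_eq_zero, mul_zero]
      intro x _
      obtain ⟨σ, rfl⟩ := exists_eq_cycleOf x
      exact cycleMatrix_self _
    · rw [sum_X_apply hN h]
  rw [h1] at hf
  field_simp at hf
  linarith

/-- The image of the matching `{v, μ v}` under `σ`. -/
def matchingImage {n : ℕ} (μ σ : Equiv.Perm (Fin n)) : Set (Sym2 (Fin n)) :=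
  {e | ∃ v, μ v ≠ v ∧ e = s(σ v, σ (μ v))}

theorem cycleOf_mem_containing_iff {N : ℕ} {μ σ ρ : Equiv.Perm (Fin (N + 3))} :
    cycleOf ρ ∈ containing (matchingImage μ σ) ↔
      ρ * σ ∈ matchingPlacements μ (cycleMatrix (N + 3)) := by
  rw [mem_matchingPlacements]
  constructor
  · intro h v hv
    exact h _ _ ⟨v, hv, rfl⟩
  · rintro h i j ⟨v, hv, he⟩
    rcases Sym2.eq_iff.1 he with ⟨rfl, rfl⟩ | ⟨rfl, rfl⟩
    · exact h v hv
    · exact (cycleMatrix_symm _ _).trans (h v hv)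

theorem matchingImage_tripleSwap {n k : ℕ} (h : 3 * k ≤ n) (σ : Equiv.Perm (Fin n)) :
    matchingImage (tripleSwap h) σ = {e | ∃ a : Fin k,
      e = s(σ ⟨3 * a.val, by omega⟩, σ ⟨3 * a.val + 1, by omega⟩)} := by
  ext e
  constructor
  · rintro ⟨v, hv, rfl⟩
    rw [tripleSwap_ne_iff] at hv
    refine ⟨⟨v.val / 3, by omega⟩, ?_⟩
    rcases (by omega : v.val % 3 = 0 ∨ v.val % 3 = 1) with h0 | h1
    · congr 3 <;> apply Fin.ext
      · simp only; omega
      · rw [val_tripleSwap, if_pos ⟨hv.1, h0⟩]; simp only; omega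
    · rw [Sym2.eq_swap]
      congr 3 <;> apply Fin.ext
      · rw [val_tripleSwap, if_neg (by omega), if_pos ⟨hv.1, h1⟩]; simp only; omega
      · simp only; omega
  · rintro ⟨a, rfl⟩
    refine ⟨⟨3 * a.val, by omega⟩, (tripleSwap_ne_iff h).2 ⟨by simp only; omega, by simp only; omega⟩, ?_⟩
    congr 3
    rw [if_pos ⟨by simp only; omega, by simp only; omega⟩]

theorem isPathSubset_matchingImage {n k : ℕ} (h : 3 * k ≤ n) (σ : Equiv.Perm (Fin n)) :
    IsPathSubset (matchingImage (tripleSwap h) σ) := by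
  have hadj : ∀ a : Fin k, (⊤ : SimpleGraph (Fin n)).Adj (σ ⟨3 * a.val, by omega⟩)
      (σ ⟨3 * a.val + 1, by omega⟩) := by
    intro a
    rw [SimpleGraph.top_adj, ne_eq, σ.injective.eq_iff, Fin.ext_iff]
    simp
  refine ⟨k, _, _, fun a => (hadj a).toWalk, fun a => (hadj a).isPath_toWalk, ?_, ?_⟩
  · intro a b hab z hz hz'
    rw [SimpleGraph.Adj.support_toWalk] at hz hz'
    simp only [List.mem_cons, List.not_mem_nil, or_false] at hz hz'
    rcases hz with rfl | rfl <;> rw [σ.injective.eq_iff, σ.injective.eq_iff, Fin.ext_iff,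
      Fin.ext_iff] at hz' <;> simp only at hz' <;> exact hab (Fin.ext (by omega))
  · rw [matchingImage_tripleSwap]
    simp only [SimpleGraph.Adj.edges_toWalk, List.mem_singleton]

/-- A matching is given by `k` ordered pairs of vertices. -/
theorem ncard_vertices_le {n k : ℕ} (h : 3 * k ≤ n) :
    (vertices (convexHull ℝ (Set.range fun σ : Equiv.Perm (Fin n) =>
      g (matchingImage (tripleSwap h) σ)))).ncard ≤ n ^ (2 * k) := by
  have hsub : vertices (convexHull ℝ (Set.range fun σ : Equiv.Perm (Fin n) =>
      g (matchingImage (tripleSwap h) σ))) ⊆ Set.range fun t : Fin k → Fin n × Fin n =>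
        g {e | ∃ a, e = s((t a).1, (t a).2)} := by
    refine extremePoints_convexHull_subset.trans ?_
    rintro _ ⟨σ, rfl⟩
    refine ⟨fun a => (σ ⟨3 * a.val, by omega⟩, σ ⟨3 * a.val + 1, by omega⟩), ?_⟩
    simp only [matchingImage_tripleSwap]
  refine (Set.ncard_le_ncard hsub (Set.finite_range _)).trans ?_
  rw [← Set.image_univ]
  refine (Set.ncard_image_le Set.finite_univ).trans ?_
  rw [Set.ncard_univ, Nat.card_eq_fintype_card, Fintype.card_fun, Fintype.card_prod,
    Fintype.card_fin, Fintype.card_fin, pow_mul, sq]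

/-- If the linear functional of coefficients `c` is averaged against the matchings contained in
a Hamiltonian cycle, the result is an affine function of the functional. -/
theorem sum_containing_matchingMatrix {N : ℕ} (μ : Equiv.Perm (Fin (N + 3))) {M : ℝ} (a b : ℝ)
    (hM : M = (Finset.univ.filter fun v => μ v ≠ v).card)
    (c : Matrix (Fin (N + 3)) (Fin (N + 3)) ℝ) (x : X (N + 3)) :
    open Classical in
    ∑ σ : Equiv.Perm (Fin (N + 3)), (if x ∈ containing (matchingImage μ σ) then
      ∑ u, ∑ v, c u v * matchingMatrix μ a b (σ⁻¹ u) (σ⁻¹ v) else 0) =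
    ((matchingPlacements μ (cycleMatrix (N + 3))).card : ℝ) / ((N + 3 : ℕ) : ℝ) *
      (2 * (a * M + b * (((N + 3 : ℕ) : ℝ) - M)) * (∑ u, ∑ v, if u = v then 0 else c u v) +
        (1 - 2 * a) * (M / 2) * ∑ u, ∑ v, c u v * x.1 u v) := by
  classical
  obtain ⟨ρ, rfl⟩ := exists_eq_cycleOf x
  simp only [cycleOf_mem_containing_iff]
  -- Transports matchings inside the cycle of `ρ` to placements in the base cycle.
  rw [← Equiv.sum_comp (Equiv.mulLeft ρ⁻¹)]
  simp only [Equiv.coe_mulLeft, mul_inv_cancel_left, mul_inv_rev, inv_inv, Equiv.Perm.mul_apply]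
  rw [← Finset.sum_filter, Finset.filter_mem_eq_inter, Finset.univ_inter, Finset.sum_comm]
  have key : ∀ u v, ∑ σ ∈ matchingPlacements μ (cycleMatrix (N + 3)),
      c u v * matchingMatrix μ a b (σ⁻¹ (ρ u)) (σ⁻¹ (ρ v)) =
      ((matchingPlacements μ (cycleMatrix (N + 3))).card : ℝ) / ((N + 3 : ℕ) : ℝ) *
      (2 * (a * M + b * (((N + 3 : ℕ) : ℝ) - M)) * (if u = v then 0 else c u v) +
        (1 - 2 * a) * (M / 2) * (c u v * (cycleOf ρ).1 u v)) := by
    intro u v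
    rw [← Finset.mul_sum, sum_matchingPlacements_matchingMatrix μ _ cycleMatrix_self
      cycleMatrix_eq_zero_or_one sum_cycleMatrix exists_perm_cycleMatrix a b
      (n := ((N + 3 : ℕ) : ℝ)) (by simp) hM]
    simp only [cycleOf, ρ.injective.eq_iff]
    split_ifs <;> ring
  simp only [Finset.mul_sum, ← Finset.sum_add_distrib]
  refine Finset.sum_congr rfl fun u _ => ?_
  rw [Finset.sum_comm]
  refine Finset.sum_congr rfl fun v _ => ?_
  exact key u v

end STSP

/-! ### Convex combinations of matching indicators and the main inclusion -/

namespace STSP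

/-- Rescaling the indicators to `g` gives nonnegative weights; they sum to 1 because `φ` and every
`g (Γ i)` have average 1. -/
theorem mem_convexHull_range_g {n : ℕ} {ι : Type*} [Fintype ι] (Γ : ι → Set (Sym2 (Fin n)))
    (hΓ : ∀ i, (containing (Γ i)).Nonempty) (F : ι → ℝ) (hF : ∀ i, 0 ≤ F i) {K : ℝ} (hK : 0 < K)
    (φ : X n → ℝ) (hφ : (1 / (Fintype.card (X n) : ℝ)) * ∑ x, φ x = 1)
    (h : ∀ x, K * φ x = open Classical in ∑ i, if x ∈ containing (Γ i) then F i else 0) :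
    φ ∈ convexHull ℝ (Set.range fun i => g (Γ i)) := by
  classical
  have hX : (Fintype.card (X n) : ℝ) ≠ 0 := by
    intro h0
    rw [h0, div_zero, zero_mul] at hφ
    exact zero_ne_one hφ
  have hA : ∀ i, (Fintype.card (containing (Γ i)) : ℝ) ≠ 0 := by
    intro i
    have : Nonempty (containing (Γ i)) := (hΓ i).to_subtype
    exact_mod_cast Fintype.card_ne_zero
  set w : ι → ℝ := fun i => F i * Fintype.card (containing (Γ i)) / (Fintype.card (X n) * K) with hw
  have hφw : φ = ∑ i, w i • g (Γ i) := by
    funext x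
    have := h x
    refine mul_left_cancel₀ hK.ne' (this.trans ?_)
    rw [Finset.sum_apply, Finset.mul_sum]
    refine Finset.sum_congr rfl fun i _ => ?_
    have := hA i
    simp only [Pi.smul_apply, smul_eq_mul, g, hw]
    split_ifs
    · field_simp
    · simp
  have hsum : ∑ i, w i = 1 := by
    rw [hφw] at hφ
    simp only [Finset.sum_apply, Pi.smul_apply, smul_eq_mul] at hφ
    rw [Finset.sum_comm] at hφ
    simp only [← Finset.mul_sum, sum_g (hΓ _)] at hφ
    rw [← Finset.sum_mul, mul_comm (∑ i, w i), ← mul_assoc, one_div_mul_cancel hX, one_mul] at hφ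
    exact hφ
  rw [hφw]
  refine (convex_convexHull ℝ _).sum_mem (fun i _ => ?_) hsum fun i _ =>
    subset_convexHull ℝ _ ⟨i, rfl⟩
  exact div_nonneg (mul_nonneg (hF i) (Nat.cast_nonneg _)) (mul_nonneg (Nat.cast_nonneg _) hK.le)

/-- The functions in `Q`, contracted towards `1`, are convex combinations of normalized indicators
of matchings. -/
theorem one_add_smul_mem_convexHull {N k : ℕ} (hN : 1 ≤ N) (h : 3 * k ≤ N + 3)
    (h' : 3 * k ≤ N + 2)
    {a b : ℝ} (hab : (2 * k : ℝ) * ((((N + 3 : ℕ) : ℝ) + 2 * k - 4) * a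
      + (((N + 3 : ℕ) : ℝ) - 2 * k) * b) = 2 * k)
    (hab' : 2 * k * a + (2 * ((N + 3 : ℕ) : ℝ) - 2 * k - 2) * b = 2)
    (h0 : 0 ≤ 2 * a * (2 * k * (2 * k - 2))) (h1 : 2 * a * (2 * k * (2 * k - 2)) ≤ 1)
    (hk : k ≤ 1 → a = 0) {f : X (N + 3) → ℝ} (hf : f ∈ Q (N + 3)) :
    1 + ((1 - 2 * a) * k / ((N + 3 : ℕ) : ℝ)) • (f - 1) ∈
      convexHull ℝ (Set.range fun σ : Equiv.Perm (Fin (N + 3)) =>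
        g (matchingImage (tripleSwap h) σ)) := by
  obtain ⟨⟨c, hc⟩, hf0, hf1⟩ := hf
  have hX : (Fintype.card (X (N + 3)) : ℝ) ≠ 0 := by exact_mod_cast Fintype.card_ne_zero
  have hn : ((N + 3 : ℕ) : ℝ) ≠ 0 := by positivity
  have hone : (1 : Equiv.Perm (Fin (N + 3))) ∈
      matchingPlacements (tripleSwap h) (cycleMatrix (N + 3)) :=
    mem_matchingPlacements.2 fun u hu => cycleMatrix_tripleSwap h hu
  refine mem_convexHull_range_g _ (fun σ => ⟨cycleOf σ⁻¹, ?_⟩) (fun σ => ∑ u, ∑ v,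
    c u v * matchingMatrix (tripleSwap h) a b (σ⁻¹ u) (σ⁻¹ v)) (fun σ => ?_)
    (K := ((matchingPlacements (tripleSwap h) (cycleMatrix (N + 3))).card : ℝ)) ?_ _ ?_ fun x => ?_
  · rw [cycleOf_mem_containing_iff, inv_mul_cancel]
    exact hone
  · exact sum_mul_matchingMatrix_tripleSwap_nonneg h h' hab hab' h0 h1 hk c
      (fun σ => (hf0 (cycleOf σ)).trans_eq (hc _)) σ
  · exact_mod_cast Finset.card_pos.2 ⟨1, hone⟩
  · simp only [Pi.add_apply, Pi.smul_apply, Pi.sub_apply, Pi.one_apply, smul_eq_mul,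
      Finset.sum_add_distrib, ← Finset.mul_sum, Finset.sum_sub_distrib, Finset.sum_const,
      Finset.card_univ, nsmul_eq_mul, mul_one]
    have : ∑ x, f x = Fintype.card (X (N + 3)) := by
      field_simp at hf1
      exact hf1
    rw [this, sub_self, mul_zero, add_zero, one_div_mul_cancel hX]
  · rw [sum_containing_matchingMatrix (tripleSwap h) (M := 2 * k) a b
      (by rw [card_support_tripleSwap]; simp) c x, sum_offDiag_coeff hN hf1 hc, ← hc]
    simp only [Pi.add_apply, Pi.smul_apply, Pi.sub_apply, Pi.one_apply, smul_eq_mul]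
    field_simp
    set G : ℝ := ((matchingPlacements (tripleSwap h) (cycleMatrix (N + 3))).card : ℝ)
    -- The constant terms agree because the entries of the matching matrix sum to `2 * n`: add the
    -- row conditions over all vertices.
    linear_combination G * (-(1 : ℝ) / 2) * hab - G * ((((N + 3 : ℕ) : ℝ) - 2 * k) / 2) * hab'

end STSP

theorem theorem1 :
    ∃ C D : ℝ, ∀ n k : ℕ, 4 ≤ n → (k : ℝ) ≤ (n : ℝ) ^ ((1 : ℝ) / 3) →
      ∃ (P : Set (STSP.X n → ℝ)) (c : ℝ),
        STSP.IsPolytope P ∧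
        (∀ v ∈ STSP.vertices P,
          ∃ Γ : Set (Sym2 (Fin n)), STSP.IsPathSubset Γ ∧ v = STSP.g Γ) ∧
        ((STSP.vertices P).ncard : ℝ) ≤ C * (n : ℝ) ^ (4 * k) ∧
        |c - (k : ℝ) / (n : ℝ)| ≤ D / (n : ℝ) ∧
        (1 ≤ k → 0 < c) ∧
        c • (STSP.Q n - {1}) ⊆ (P ∩ (STSP.L n : Set (STSP.X n → ℝ))) - {1} ∧
        (P ∩ (STSP.L n : Set (STSP.X n → ℝ))) - {1} ⊆ STSP.Q n - {1} := by
  refine ⟨1, 1, fun n k hn hk => ?_⟩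
  have hk3 : k ^ 3 ≤ n := by
    have h1 : (k : ℝ) ^ 3 ≤ ((n : ℝ) ^ ((1 : ℝ) / 3)) ^ 3 := pow_le_pow_left₀ k.cast_nonneg hk 3
    rw [← Real.rpow_natCast ((n : ℝ) ^ ((1 : ℝ) / 3)), ← Real.rpow_mul n.cast_nonneg] at h1
    norm_num at h1
    exact_mod_cast h1
  have h4k : 4 * k ≤ n := by
    rcases (by omega : k ≤ 1 ∨ 2 ≤ k) with h | h
    · omega
    · nlinarith [Nat.mul_le_mul h h]
  obtain ⟨a, b, ha, ha1, hak, hab, hab', h0, h1, hk1⟩ := exists_matching_weights hn hk3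
  obtain ⟨N, rfl⟩ : ∃ N, n = N + 3 := ⟨n - 3, by omega⟩
  have h3 : 3 * k ≤ N + 3 := by omega
  have hnpos : (0 : ℝ) < ((N + 3 : ℕ) : ℝ) := by positivity
  set P : Set (STSP.X (N + 3) → ℝ) := convexHull ℝ (Set.range fun σ : Equiv.Perm (Fin (N + 3)) =>
    STSP.g (STSP.matchingImage (tripleSwap h3) σ)) with hP
  have hPL : P ∩ (STSP.L (N + 3) : Set (STSP.X (N + 3) → ℝ)) ⊆ STSP.Q (N + 3) := by
    refine STSP.convexHull_range_g_inter_L_subset _ fun σ => ⟨STSP.cycleOf σ⁻¹, ?_⟩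
    rw [STSP.cycleOf_mem_containing_iff, inv_mul_cancel]
    exact mem_matchingPlacements.2 fun u hu => cycleMatrix_tripleSwap h3 hu
  refine ⟨P, (1 - 2 * a) * k / ((N + 3 : ℕ) : ℝ), STSP.isPolytope_convexHull_range _, ?_, ?_, ?_,
    ?_, ?_, Set.sub_subset_sub_right hPL⟩
  · intro v hv
    obtain ⟨σ, rfl⟩ := extremePoints_convexHull_subset hv
    exact ⟨_, STSP.isPathSubset_matchingImage h3 σ, rfl⟩
  · rw [one_mul]
    have h2 : (N + 3) ^ (2 * k) ≤ (N + 3) ^ (4 * k) := Nat.pow_le_pow_right (by omega) (by omega)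
    exact_mod_cast (STSP.ncard_vertices_le h3).trans h2
  -- The deviation from `k / n` is `2 * a * k / n`, and `2 * a * k ≤ 1`.
  · rw [← sub_div, abs_div, abs_of_pos hnpos]
    refine div_le_div_of_nonneg_right ?_ hnpos.le
    rw [abs_le]
    have : 0 ≤ 2 * a * k := by positivity
    constructor <;> linarith
  · intro hk'
    have : (0 : ℝ) < k := by exact_mod_cast hk'
    exact div_pos (mul_pos (by linarith) this) hnpos
  · rintro _ ⟨_, ⟨f, hf, _, rfl, rfl⟩, rfl⟩
    refine ⟨_, ⟨STSP.one_add_smul_mem_convexHull (by omega) h3 (by omega) hab hab' h0 h1 hk1 hf,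
      ?_⟩, 1, rfl, ?_⟩
    · exact Submodule.add_mem _ STSP.one_mem_L
        (Submodule.smul_mem _ _ (Submodule.sub_mem _ hf.1 STSP.one_mem_L))
    · simp
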